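/- Let $\mathcal P$ be the cone of positive definite (real or complex) matrices of a fixed size. For a piecewise smooth path $\alpha:[a,b]\to\mathcal P$ let $L(\alpha)=\int_a^b\|\alpha(t)^{-1/2}\alpha'(t)\alpha(t)^{-1/2}\|_2\,dt$, where $\|\cdot\|_2$ is the Frobenius norm, and let $\delta(A,B)$ be the infimum of $L(\alpha)$ over the piecewise smooth paths $\alpha$ in $\mathcal P$ that connect $A$ with $B$. For $t\in[0,1]$ write $A\#_tB=A^{1/2}(A^{-1/2}BA^{-1/2})^tA^{1/2}$, and for a sequence $X=(X_n)_{n\ge1}$ in $\mathcal P$ define its inductive means by $S_1(X)=X_1$ and $S_n(X)=S_{n-1}(X)\#_{1/n}X_n$ for $n\ge2$. Let $m\ge1$, $A_1,\dots,A_m\in\mathcal P$ and $k\ge1$. Then the function $C\mapsto\sum_{j=1}^m\delta^2(A_j,C)$ on $\mathcal P$ has exactly one minimizer $G=G(A_1,\dots,A_m)$, and the following holds. For a sequence $\sigma=(\sigma_j)_{j\ge1}$ of permutations of $km$ elements let $\mathbf A^{(k)}_\sigma$ be the concatenation of blocks of length $km$, the $j$-th of which is the list $(A_1,\dots,A_m,\dots,A_1,\dots,A_m)$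 ($k$ repetitions of $A_1,\dots,A_m$) rearranged by $\sigma_j$. There is a constant $L>0$, depending only on $A_1,\dots,A_m$ and $k$, such that $$\delta^2\big(S_n(\mathbf A^{(k)}_\sigma),\,G\big)\le\frac Ln\qquad\text{for all }\sigma\text{ and all }n\ge1 .$$ In particular, $\lim_{n\to\infty}S_n(\mathbf A^{(k)}_\sigma)=G$ for every $\sigma$. -/

import Mathlib

/-! The Riemannian geometry of positive definite matrices, the least squares mean and the
inductive means. Matrices have entries in `𝕜 = ℝ` or `ℂ`; "positive" means positive definite. -/

open scoped ComplexOrder MatrixOrder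

noncomputable section

namespace PosMat

open Set
open scoped ContDiff

variable {𝕜 : Type*} [RCLike 𝕜] {ι : Type*} [Fintype ι] [DecidableEq ι]

section Distance

attribute [local instance] Matrix.frobeniusNormedAddCommGroup Matrix.frobeniusNormedSpace

/-- `α : [a, b] → P` is a piecewise smooth path in the cone `P` of positive matrices: it is
continuous, takes positive values, and there is a subdivision `a = t 0 ≤ t 1 ≤ ⋯ ≤ t N = b` such
that `α` is smooth on each closed interval `[t i, t (i + 1)]`.
(Values of `α` outside `[a, b]` are irrelevant.) -/
def IsPiecewiseSmoothPath (a b : ℝ) (α : ℝ → Matrix ι ι 𝕜) : Prop :=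
  ContinuousOn α (Icc a b) ∧ (∀ s ∈ Icc a b, (α s).PosDef) ∧
    ∃ (N : ℕ) (t : ℕ → ℝ), Monotone t ∧ t 0 = a ∧ t N = b ∧
      ∀ i < N, ContDiffOn ℝ ∞ α (Icc (t i) (t (i + 1)))

/-- The length `∫ₐᵇ ‖α(s)^(-1/2) α'(s) α(s)^(-1/2)‖₂ ds` of a path, where `‖·‖₂` is the
Frobenius norm and real powers of positive matrices are those of the functional calculus.
(The derivative is evaluated outside the finitely many break points.) -/
def pathLength (a b : ℝ) (α : ℝ → Matrix ι ι 𝕜) : ℝ :=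
  ∫ s in a..b, ‖α s ^ (-(1 / 2) : ℝ) * deriv α s * α s ^ (-(1 / 2) : ℝ)‖

/-- The Riemannian distance `δ(A, B)`: the infimum of the lengths of the piecewise smooth paths
of positive matrices that connect `A` with `B`. -/
def dist (A B : Matrix ι ι 𝕜) : ℝ :=
  sInf {ℓ : ℝ | ∃ (a b : ℝ) (α : ℝ → Matrix ι ι 𝕜), a < b ∧ IsPiecewiseSmoothPath a b α ∧
    α a = A ∧ α b = B ∧ ℓ = pathLength a b α}

end Distance

/-- The point `A #ₜ B = A^(1/2) (A^(-1/2) B A^(-1/2))^t A^(1/2)` of the geodesic from `A` to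
`B`. -/
def geodesic (A B : Matrix ι ι 𝕜) (t : ℝ) : Matrix ι ι 𝕜 :=
  A ^ (1 / 2 : ℝ) * (A ^ (-(1 / 2) : ℝ) * B * A ^ (-(1 / 2) : ℝ)) ^ t * A ^ (1 / 2 : ℝ)

/-- `G` is a least squares mean (geometric mean, barycenter) of the family `A`: it minimizes
`C ↦ ∑ⱼ δ²(Aⱼ, C)` over the positive matrices. -/
def IsLeastSquaresMean {m : ℕ} (A : Fin m → Matrix ι ι 𝕜) (G : Matrix ι ι 𝕜) : Prop :=
  G.PosDef ∧ ∀ C : Matrix ι ι 𝕜, C.PosDef → ∑ j, dist (A j) G ^ 2 ≤ ∑ j, dist (A j) C ^ 2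

/-- The inductive means `S₁ = X₁`, `Sₙ = Sₙ₋₁ #_{1/n} Xₙ` for `n ≥ 2` of the sequence
`X₁ = X 0`, `X₂ = X 1`, …. (The value at `n = 0` is a dummy.) -/
def inductiveMean (X : ℕ → Matrix ι ι 𝕜) : ℕ → Matrix ι ι 𝕜
  | 0 => X 0
  | 1 => X 0
  | n + 2 => geodesic (inductiveMean X (n + 1)) (X (n + 1)) (1 / ((n : ℝ) + 2))

/-- The sequence of consecutive blocks of length `k * m`, whose block number `j` is the list
`A 0, …, A (m - 1), …, A 0, …, A (m - 1)` (`k` repetitions) rearranged by the permutation `σ j`: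
entry `r` of the block is the entry `σ j r` of the list, which is `A (σ j r mod m)`. -/
def blockSeq {k m : ℕ} [NeZero k] [NeZero m] (A : Fin m → Matrix ι ι 𝕜)
    (σ : ℕ → Equiv.Perm (Fin (k * m))) (i : ℕ) : Matrix ι ι 𝕜 :=
  A (σ (i / (k * m)) (Fin.ofNat (k * m) i)).modNat

end PosMat

end

open scoped ComplexOrder MatrixOrder

noncomputable section

namespace PosMat

open Set

/-! ### Least squares means and inductive means in metric spaces of nonpositive curvature -/

section NonpositiveCurvature

variable {M : Type*} [MetricSpace M]

/-! The cone of positive matrices with the distance `δ` has nonpositive curvature, and both the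
unique mean and the rate of convergence come from the comparison inequality `IsCAT0` alone.

Geometry. The key is `norm_logm_sub_sq_le`: in eigenbases of the two matrices it reduces to |x| ≤
sinh |x|. Applied to difference quotients along a path it shows that `logm` does not increase
lengths, so ‖log B - log A‖ ≤ δ(A, B) (`norm_logm_sub_le_dist`), without differentiating the matrix
logarithm. On the powers of one matrix this is an equality (`dist_rpow`), and by congruence
invariance (`dist_conj`) any pair A, B can be moved to such powers. Moving the point A #ₜ B to the
identity and comparing with the Euclidean space of logarithms gives the comparison inequality
(`dist_geodesic_sq_le`), which in turn gives the triangle inequality.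

Rate. Let f be the sum of squared distances to the points of the family. Comparison at each step of
the inductive mean bounds the growth of n δ²(Sₙ, G) by δ²(G, X) - δ²(Sₙ, X), up to small errors,
where X is the new point. Within a block the mean moves by O(1/n), so Sₙ may be frozen at the start
of the block; the order of the block then no longer matters. The sum over the block is k (f(G) -
f(Sₙ)) up to errors, at most -km δ²(G, Sₙ) by `IsCAT0.variance`. The resulting recursion over blocks
telescopes to the bound L / n. -/

/-- The points `γ x y t` satisfy the comparison inequality of spaces of nonpositive curvature. -/
def IsCAT0 (γ : M → M → ℝ → M) : Prop :=
  ∀ x y z : M, ∀ t ∈ Icc (0 : ℝ) 1, Dist.dist z (γ x y t) ^ 2 ≤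
    (1 - t) * Dist.dist z x ^ 2 + t * Dist.dist z y ^ 2 - t * (1 - t) * Dist.dist x y ^ 2

variable {γ : M → M → ℝ → M}

theorem IsCAT0.dist_left (hγ : IsCAT0 γ) (x y : M) {t : ℝ} (ht : t ∈ Icc (0 : ℝ) 1) :
    Dist.dist x (γ x y t) ≤ t * Dist.dist x y := by
  rw [← sq_le_sq₀ dist_nonneg (mul_nonneg ht.1 dist_nonneg)]
  have := hγ x y x t ht
  rw [dist_self] at this
  linarith

/-- The variance inequality. -/
theorem IsCAT0.variance (hγ : IsCAT0 γ) {m : ℕ} {A : Fin m → M} {G : M}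
    (hG : ∀ C, ∑ j, Dist.dist (A j) G ^ 2 ≤ ∑ j, Dist.dist (A j) C ^ 2) (z : M) :
    m * Dist.dist G z ^ 2 ≤ ∑ j, Dist.dist (A j) z ^ 2 - ∑ j, Dist.dist (A j) G ^ 2 := by
  set f := fun C => ∑ j, Dist.dist (A j) C ^ 2 with hf
  -- Minimality of `G` is tested against points of the geodesic from `G` to `z`; after division by
  -- `t` the factor `1 - t` is removed by letting `t` tend to 0.
  have key : ∀ t ∈ Ioo (0 : ℝ) 1, (1 - t) * (m * Dist.dist G z ^ 2) ≤ f z - f G := by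
    intro t ht
    have h1 : f (γ G z t) ≤ (1 - t) * f G + t * f z - t * (1 - t) * (m * Dist.dist G z ^ 2) := by
      have := Finset.sum_le_sum fun j (_ : j ∈ Finset.univ) => hγ G z (A j) t ⟨ht.1.le, ht.2.le⟩
      rw [Finset.sum_sub_distrib, Finset.sum_add_distrib, ← Finset.mul_sum, ← Finset.mul_sum,
        Finset.sum_const, Finset.card_univ, Fintype.card_fin, nsmul_eq_mul] at this
      linarith
    have h2 := hG (γ G z t)
    have h3 : t * ((1 - t) * (m * Dist.dist G z ^ 2)) ≤ t * (f z - f G) := by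
      have h4 : f G ≤ f (γ G z t) := h2
      linarith
    exact le_of_mul_le_mul_left h3 ht.1
  have hlim : Filter.Tendsto (fun t : ℝ => (1 - t) * (m * Dist.dist G z ^ 2)) (nhdsWithin 0 (Ioi 0))
      (nhds ((1 - 0) * (m * Dist.dist G z ^ 2))) :=
    (Continuous.tendsto (by fun_prop) 0).mono_left nhdsWithin_le_nhds
  rw [sub_zero, one_mul] at hlim
  refine le_of_tendsto hlim ?_
  filter_upwards [Ioo_mem_nhdsGT (zero_lt_one (α := ℝ))] with t ht using key t ht

theorem IsCAT0.unique (hγ : IsCAT0 γ) {m : ℕ} [NeZero m] {A : Fin m → M} {G G' : M}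
    (hG : ∀ C, ∑ j, Dist.dist (A j) G ^ 2 ≤ ∑ j, Dist.dist (A j) C ^ 2)
    (hG' : ∀ C, ∑ j, Dist.dist (A j) G' ^ 2 ≤ ∑ j, Dist.dist (A j) C ^ 2) : G' = G := by
  have h1 := hγ.variance hG G'
  have h2 := hG' G
  have hm : (0 : ℝ) < m := Nat.cast_pos.2 (Nat.pos_of_neZero m)
  have h3 : Dist.dist G G' ^ 2 ≤ 0 := by
    by_contra! h
    nlinarith [mul_pos hm h]
  exact (dist_eq_zero.1 (pow_eq_zero_iff two_ne_zero |>.1 (le_antisymm h3 (sq_nonneg _)))).symm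

/-- If consecutive blocks of length `p` of the sequence `X` average the squared distances to the
points `A j` uniformly, then the inductive means of `X` converge to the mean `G` of `A` at the
rate `1 / √n`. -/
theorem IsCAT0.inductiveMean_rate (hγ : IsCAT0 γ) {m : ℕ} {A : Fin m → M} {G : M}
    (hG : ∀ C, ∑ j, Dist.dist (A j) G ^ 2 ≤ ∑ j, Dist.dist (A j) C ^ 2) {k : ℕ} (hkm : 0 < k * m)
    {R : ℝ} (hR : ∀ j, Dist.dist G (A j) ≤ R) {X S : ℕ → M} (hX : ∀ n, ∃ j, X n = A j)
    (hsum : ∀ (q : ℕ) (z : M), ∑ i ∈ Finset.range (k * m), Dist.dist (X (q * (k * m) + i)) z ^ 2 =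
      k * ∑ j, Dist.dist (A j) z ^ 2)
    (hS0 : S 0 = X 0) (hS1 : S 1 = X 0)
    (hS : ∀ n, S (n + 2) = γ (S (n + 1)) (X (n + 1)) (1 / ((n : ℝ) + 2))) (n : ℕ) :
    n * Dist.dist (S n) G ^ 2 ≤ (k * m : ℕ) * (12 * R ^ 2 * (k * m : ℕ) + 2 * R ^ 2) := by
  set p := k * m with hp
  have hp1 : (1 : ℝ) ≤ p := by exact_mod_cast hkm
  have hXR (n) : Dist.dist G (X n) ≤ R := by obtain ⟨j, hj⟩ := hX n; rw [hj]; exact hR j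
  have hR0 : 0 ≤ R := dist_nonneg.trans (hXR 0)
  have sq_le {x : ℝ} (h0 : 0 ≤ x) (h : x ≤ R) : x ^ 2 ≤ R ^ 2 := pow_le_pow_left₀ h0 h 2
  have mem (n : ℕ) : (1 / ((n : ℝ) + 2)) ∈ Icc (0 : ℝ) 1 :=
    ⟨by positivity, by rw [div_le_one (by positivity)]; linarith [n.cast_nonneg (α := ℝ)]⟩
  -- Balls about `G` are convex for `γ`, so the means never leave the ball that contains the data.
  have hSR (n) : Dist.dist G (S n) ≤ R := by
    rcases n with _ | n
    · rw [hS0]; exact hXR 0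
    induction n with
    | zero => rw [hS1]; exact hXR 0
    | succ n ih =>
      rw [hS, ← sq_le_sq₀ dist_nonneg hR0]
      have h1 := hγ (S (n + 1)) (X (n + 1)) G _ (mem n)
      have h2 := sq_le dist_nonneg ih
      have h3 := sq_le dist_nonneg (hXR (n + 1))
      obtain ⟨h4, h5⟩ := mem n
      set t := 1 / ((n : ℝ) + 2)
      nlinarith [mul_nonneg (mul_nonneg h4 (sub_nonneg.2 h5))
        (sq_nonneg (Dist.dist (S (n + 1)) (X (n + 1))))]
  have hSX (n i) : Dist.dist (S n) (X i) ≤ 2 * R := by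
    have := dist_triangle_left (S n) (X i) G
    linarith [hSR n, hXR i]
  -- The comparison inequality with base point `G` and weight `1 / (n + 1)`, multiplied by `n + 1`.
  -- For `n = 0` the dummy `S 0` has weight zero.
  have step (n : ℕ) : (n + 1) * Dist.dist G (S (n + 1)) ^ 2 ≤ n * Dist.dist G (S n) ^ 2 +
      Dist.dist G (X n) ^ 2 - n / (n + 1) * Dist.dist (S n) (X n) ^ 2 := by
    rcases n with _ | n
    · simp [hS1]
    · have h1 := hγ (S (n + 1)) (X (n + 1)) G _ (mem n)
      rw [← hS] at h1
      have h2 := mul_le_mul_of_nonneg_left h1 (by positivity : (0 : ℝ) ≤ n + 2)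
      push_cast
      have h0 : (n : ℝ) + 2 ≠ 0 := by positivity
      have e : ((n : ℝ) + 2) * ((1 - 1 / ((n : ℝ) + 2)) * Dist.dist G (S (n + 1)) ^ 2 +
          1 / ((n : ℝ) + 2) * Dist.dist G (X (n + 1)) ^ 2 - 1 / ((n : ℝ) + 2) *
            (1 - 1 / ((n : ℝ) + 2)) * Dist.dist (S (n + 1)) (X (n + 1)) ^ 2) =
          (n + 1) * Dist.dist G (S (n + 1)) ^ 2 + Dist.dist G (X (n + 1)) ^ 2 -
            (n + 1) / (n + 1 + 1) * Dist.dist (S (n + 1)) (X (n + 1)) ^ 2 := by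
        rw [add_assoc (n : ℝ) 1 1, one_add_one_eq_two]
        field_simp
        ring
      rw [e] at h2
      rw [add_assoc (n : ℝ) 1 1, one_add_one_eq_two] at h2 ⊢
      exact h2
  have move (n : ℕ) : Dist.dist (S n) (S (n + 1)) ≤ 2 * R / (n + 1) := by
    rcases n with _ | n
    · rw [hS0, hS1, dist_self]; positivity
    · rw [hS]
      refine (hγ.dist_left _ _ (mem n)).trans ?_
      have := hSX (n + 1) (n + 1)
      push_cast
      rw [add_assoc (n : ℝ) 1 1, one_add_one_eq_two, one_div_mul_eq_div]
      gcongr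
  have moves (N i : ℕ) : Dist.dist (S N) (S (N + i)) ≤ i * (2 * R / (N + 1)) := by
    induction i with
    | zero => simp
    | succ i ih =>
      have h1 := dist_triangle (S N) (S (N + i)) (S (N + (i + 1)))
      have h2 : 2 * R / ((N + i : ℕ) + 1) ≤ 2 * R / (N + 1) := by
        gcongr
        linarith
      have h3 := move (N + i)
      push_cast at h2 h3 ⊢
      rw [← add_assoc] at h1 ⊢
      linarith
  -- 12 = 8 + 4: the share 8 pays for replacing `S (N + i)` by `S N` in the squared distance to `X
  -- (N + i)`, the share 4 for replacing the weight `n / (n + 1)` by 1.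
  set C := 12 * R ^ 2 * p with hC
  have hC0 : 0 ≤ C := by positivity
  have blockStep (N i : ℕ) (hi : i < p) :
      ((N + i : ℕ) + 1 : ℝ) * Dist.dist G (S (N + i + 1)) ^ 2 ≤
        (N + i : ℕ) * Dist.dist G (S (N + i)) ^ 2 + Dist.dist (X (N + i)) G ^ 2 -
          Dist.dist (X (N + i)) (S N) ^ 2 + C / (N + 1) := by
    have h1 := step (N + i)
    have hip : (i : ℝ) ≤ p := by exact_mod_cast hi.le
    have h2 : Dist.dist (S N) (X (N + i)) - Dist.dist (S (N + i)) (X (N + i)) ≤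
        p * (2 * R / (N + 1)) := by
      have h3 := dist_triangle (S N) (S (N + i)) (X (N + i))
      have h4 := moves N i
      have h5 : i * (2 * R / (N + 1)) ≤ p * (2 * R / ((N : ℝ) + 1)) := by gcongr
      linarith
    have h3 : Dist.dist (S N) (X (N + i)) ^ 2 - Dist.dist (S (N + i)) (X (N + i)) ^ 2 ≤
        8 * R ^ 2 * p / (N + 1) := by
      have h4 := hSX N (N + i)
      have h5 := hSX (N + i) (N + i)
      have e : 8 * R ^ 2 * p / (N + 1) = p * (2 * R / ((N : ℝ) + 1)) * (4 * R) := by ring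
      rw [e, sq_sub_sq, mul_comm]
      refine (mul_le_mul_of_nonneg_right h2 (by positivity)).trans ?_
      refine mul_le_mul_of_nonneg_left (by linarith) (by positivity)
    have h4 : Dist.dist (S (N + i)) (X (N + i)) ^ 2 -
        (N + i : ℕ) / ((N + i : ℕ) + 1) * Dist.dist (S (N + i)) (X (N + i)) ^ 2 ≤
          4 * R ^ 2 * p / (N + 1) := by
      have e : Dist.dist (S (N + i)) (X (N + i)) ^ 2 -
        (N + i : ℕ) / ((N + i : ℕ) + 1) * Dist.dist (S (N + i)) (X (N + i)) ^ 2 =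
          Dist.dist (S (N + i)) (X (N + i)) ^ 2 / ((N + i : ℕ) + 1) := by field_simp; ring
      rw [e]
      have h5 := pow_le_pow_left₀ dist_nonneg (hSX (N + i) (N + i)) 2
      gcongr
      · nlinarith [sq_nonneg R]
      · simp
    have e : C / (N + 1) = 8 * R ^ 2 * p / (N + 1) + 4 * R ^ 2 * p / ((N : ℝ) + 1) := by
      rw [hC]; ring
    rw [dist_comm (X (N + i)) G, dist_comm (X (N + i)) (S N), e]
    linarith
  -- With the mean frozen at `S N`, `hsum` turns the block sums into `k` times the objective at `G`
  -- and at `S N`, and the variance inequality supplies the gain `-p * d²`.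
  have block (q : ℕ) : ((q * p + p : ℕ) : ℝ) * Dist.dist G (S (q * p + p)) ^ 2 ≤
      (q * p : ℕ) * Dist.dist G (S (q * p)) ^ 2 - p * Dist.dist G (S (q * p)) ^ 2 +
        p * (C / ((q * p : ℕ) + 1)) := by
    set N := q * p with hN
    have h1 : ∀ i ≤ p, ((N + i : ℕ) : ℝ) * Dist.dist G (S (N + i)) ^ 2 ≤
        N * Dist.dist G (S N) ^ 2 + ∑ r ∈ Finset.range i, Dist.dist (X (N + r)) G ^ 2 -
          ∑ r ∈ Finset.range i, Dist.dist (X (N + r)) (S N) ^ 2 + i * (C / (N + 1)) := by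
      intro i
      induction i with
      | zero => simp
      | succ i ih =>
        intro hi
        have h2 := ih (by omega)
        have h3 := blockStep N i hi
        rw [Finset.sum_range_succ, Finset.sum_range_succ]
        push_cast at h2 h3 ⊢
        rw [← add_assoc, ← add_assoc]
        linarith
    have h2 := h1 p le_rfl
    rw [hsum q G, hsum q (S N)] at h2
    have h3 := mul_le_mul_of_nonneg_left (hγ.variance hG (S N)) k.cast_nonneg (α := ℝ)
    have e : (p : ℝ) = k * m := by rw [hp]; push_cast; rfl
    rw [mul_sub, ← mul_assoc, ← e] at h3
    linarith
  have block' (q : ℕ) : ((q : ℝ) + 1) * Dist.dist G (S ((q + 1) * p)) ^ 2 ≤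
      (q - 1) * Dist.dist G (S (q * p)) ^ 2 + C / (q * p + 1) := by
    have h := block q
    have hp0 : (0 : ℝ) < p := by linarith
    refine le_of_mul_le_mul_left ?_ hp0
    rw [add_one_mul q p]
    push_cast at h
    linarith
  -- Multiplying `block'` by `q` makes `(q - 1) * q * d²` a telescoping quantity that grows by at
  -- most `C` per block.
  have grow (q : ℕ) : ((q : ℝ) - 1) * q * Dist.dist G (S (q * p)) ^ 2 ≤ C * q := by
    induction q with
    | zero => simp
    | succ q ih =>
      have h1 := mul_le_mul_of_nonneg_left (block' q) (q.cast_nonneg (α := ℝ))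
      have h2 : q * (C / (q * p + 1)) ≤ C := by
        rw [mul_div_assoc', div_le_iff₀ (by positivity), mul_comm]
        refine mul_le_mul_of_nonneg_left ?_ hC0
        nlinarith [q.cast_nonneg (α := ℝ)]
      push_cast
      rw [mul_add] at h1
      linarith
  have atBlock (q : ℕ) : q * Dist.dist G (S (q * p)) ^ 2 ≤ C + R ^ 2 := by
    rcases q with _ | q
    · simp; positivity
    · have h1 := grow (q + 1)
      have hq : (0 : ℝ) < (q + 1 : ℕ) := by positivity
      rw [mul_right_comm, mul_comm _ ((q + 1 : ℕ) : ℝ), mul_comm C] at h1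
      have h2 := le_of_mul_le_mul_left h1 hq
      have h3 := sq_le dist_nonneg (hSR ((q + 1) * p))
      linarith
  -- An incomplete last block of fewer than `p` steps adds at most `R ^ 2` per step.
  have tail (N i : ℕ) : ((N + i : ℕ) : ℝ) * Dist.dist G (S (N + i)) ^ 2 ≤
      N * Dist.dist G (S N) ^ 2 + i * R ^ 2 := by
    induction i with
    | zero => simp
    | succ i ih =>
      have h1 := step (N + i)
      have h2 := sq_le dist_nonneg (hXR (N + i))
      have h3 : 0 ≤ (N + i : ℕ) / ((N + i : ℕ) + 1 : ℝ) * Dist.dist (S (N + i)) (X (N + i)) ^ 2 := by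
        positivity
      push_cast at ih h1 h3 ⊢
      rw [← add_assoc, ← add_assoc]
      linarith
  have h1 := tail (n / p * p) (n % p)
  rw [Nat.div_add_mod'] at h1
  have h2 := mul_le_mul_of_nonneg_left (atBlock (n / p)) (p.cast_nonneg (α := ℝ))
  have h3 : ((n % p : ℕ) : ℝ) * R ^ 2 ≤ p * R ^ 2 := by
    gcongr
    exact (Nat.mod_lt n hkm).le
  rw [dist_comm]
  push_cast at h1
  linarith

end NonpositiveCurvature

open scoped ContDiff
open Matrix Filter Topology MeasureTheory

variable {𝕜 : Type*} [RCLike 𝕜] {ι : Type*} [Fintype ι] [DecidableEq ι]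

attribute [local instance] Matrix.frobeniusNormedAddCommGroup Matrix.frobeniusNormedSpace

/-! ### Functions of Hermitian matrices and the Frobenius norm -/

theorem norm_sq_eq_sum (M : Matrix ι ι 𝕜) : ‖M‖ ^ 2 = ∑ i, ∑ j, ‖M i j‖ ^ 2 := by
  rw [frobenius_norm_def, ← Real.sqrt_eq_rpow, Real.sq_sqrt (by positivity)]
  simp

theorem norm_sq_eq_trace (M : Matrix ι ι 𝕜) : ‖M‖ ^ 2 = RCLike.re (Mᴴ * M).trace := by
  rw [norm_sq_eq_sum, Finset.sum_comm]
  simp only [Matrix.trace, Matrix.diag, Matrix.mul_apply, Matrix.conjTranspose_apply, map_sum]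
  refine Finset.sum_congr rfl fun i _ => Finset.sum_congr rfl fun j _ => ?_
  rw [RCLike.star_def, RCLike.conj_mul]
  norm_cast

theorem norm_unitary_mul_mul (U V : Matrix.unitaryGroup ι 𝕜) (M : Matrix ι ι 𝕜) :
    ‖(star (U : Matrix ι ι 𝕜)) * M * V‖ = ‖M‖ := by
  rw [← sq_eq_sq₀ (norm_nonneg _) (norm_nonneg _), norm_sq_eq_trace, norm_sq_eq_trace]
  have hU : (U : Matrix ι ι 𝕜) * (U : Matrix ι ι 𝕜)ᴴ = 1 := Unitary.mul_star_self_of_mem U.2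
  have hV : (V : Matrix ι ι 𝕜) * (V : Matrix ι ι 𝕜)ᴴ = 1 := Unitary.mul_star_self_of_mem V.2
  congr 1
  simp only [star_eq_conjTranspose, conjTranspose_mul, conjTranspose_conjTranspose, mul_assoc]
  rw [← mul_assoc (U : Matrix ι ι 𝕜), hU, one_mul, trace_mul_comm]
  simp only [mul_assoc, hV, mul_one]

theorem cfc_eq_mul {A : Matrix ι ι 𝕜} (hA : A.IsHermitian) (f : ℝ → ℝ) :
    cfc f A = (hA.eigenvectorUnitary : Matrix ι ι 𝕜) *
      diagonal (fun i => ((f (hA.eigenvalues i) : ℝ) : 𝕜)) *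
        star (hA.eigenvectorUnitary : Matrix ι ι 𝕜) := by
  rw [hA.cfc_eq, IsHermitian.cfc, Unitary.conjStarAlgAut_apply]
  rfl

/-- The entries of the transition matrix between eigenbases of `A` and `B` turn a difference of
products of functions of `A` and `B` into a weighted double sum over eigenvalues. -/
theorem norm_sq_cfc_sub {A B : Matrix ι ι 𝕜} (hA : A.IsHermitian) (hB : B.IsHermitian)
    (f₁ g₁ f₂ g₂ : ℝ → ℝ) :
    ‖cfc f₁ A * cfc g₁ B - cfc f₂ A * cfc g₂ B‖ ^ 2 =
      ∑ i, ∑ j, (f₁ (hA.eigenvalues i) * g₁ (hB.eigenvalues j) -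
        f₂ (hA.eigenvalues i) * g₂ (hB.eigenvalues j)) ^ 2 *
        ‖(star (hA.eigenvectorUnitary : Matrix ι ι 𝕜) *
          (hB.eigenvectorUnitary : Matrix ι ι 𝕜)) i j‖ ^ 2 := by
  set U := hA.eigenvectorUnitary
  set V := hB.eigenvectorUnitary
  have hU : star (U : Matrix ι ι 𝕜) * (U : Matrix ι ι 𝕜) = 1 := Unitary.star_mul_self_of_mem U.2
  have hV : star (V : Matrix ι ι 𝕜) * (V : Matrix ι ι 𝕜) = 1 := Unitary.star_mul_self_of_mem V.2
  have key (f g : ℝ → ℝ) : star (U : Matrix ι ι 𝕜) * (cfc f A * cfc g B) * V =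
      diagonal (fun i => ((f (hA.eigenvalues i) : ℝ) : 𝕜)) *
        (star (U : Matrix ι ι 𝕜) * (V : Matrix ι ι 𝕜)) *
          diagonal (fun i => ((g (hB.eigenvalues i) : ℝ) : 𝕜)) := by
    rw [cfc_eq_mul hA, cfc_eq_mul hB]
    simp only [mul_assoc]
    rw [hV, mul_one, ← mul_assoc (star (U : Matrix ι ι 𝕜)), hU, one_mul]
  rw [← norm_unitary_mul_mul U V, mul_sub, sub_mul, key, key, norm_sq_eq_sum]
  refine Finset.sum_congr rfl fun i _ => Finset.sum_congr rfl fun j _ => ?_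
  rw [Matrix.sub_apply, mul_diagonal, mul_diagonal, diagonal_mul, diagonal_mul, mul_right_comm,
    mul_right_comm _ _ (((g₂ _ : ℝ)) : 𝕜), ← sub_mul, norm_mul, mul_pow]
  congr 1
  rw [← RCLike.ofReal_mul, ← RCLike.ofReal_mul, ← RCLike.ofReal_sub, RCLike.norm_ofReal, sq_abs]

/-- Both norms are double sums over pairs of eigenvalues with the same nonnegative weights, so a
scalar inequality on these pairs is enough, although `A` and `B` need not commute. -/
theorem norm_cfc_sub_le {A B : Matrix ι ι 𝕜} (hA : A.IsHermitian) (hB : B.IsHermitian)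
    (f₁ g₁ f₂ g₂ f₃ g₃ f₄ g₄ : ℝ → ℝ) {c : ℝ} (hc : 0 ≤ c)
    (h : ∀ i j, |f₁ (hA.eigenvalues i) * g₁ (hB.eigenvalues j) -
        f₂ (hA.eigenvalues i) * g₂ (hB.eigenvalues j)| ≤
      c * |f₃ (hA.eigenvalues i) * g₃ (hB.eigenvalues j) -
        f₄ (hA.eigenvalues i) * g₄ (hB.eigenvalues j)|) :
    ‖cfc f₁ A * cfc g₁ B - cfc f₂ A * cfc g₂ B‖ ≤
      c * ‖cfc f₃ A * cfc g₃ B - cfc f₄ A * cfc g₄ B‖ := by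
  rw [← sq_le_sq₀ (norm_nonneg _) (by positivity), mul_pow, norm_sq_cfc_sub hA hB,
    norm_sq_cfc_sub hA hB, Finset.mul_sum]
  refine Finset.sum_le_sum fun i _ => ?_
  rw [Finset.mul_sum]
  refine Finset.sum_le_sum fun j _ => ?_
  rw [← mul_assoc]
  gcongr
  rw [← sq_abs, ← sq_abs (_ - _), ← mul_pow]
  exact pow_le_pow_left₀ (abs_nonneg _) (h i j) 2

/-- A function of `A` is a linear combination of fixed matrices. -/
theorem exists_cfc_eq_sum {A : Matrix ι ι 𝕜} (hA : A.IsHermitian) :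
    ∃ P : ι → Matrix ι ι 𝕜, ∀ f : ℝ → ℝ, cfc f A = ∑ i, f (hA.eigenvalues i) • P i := by
  refine ⟨fun i => (hA.eigenvectorUnitary : Matrix ι ι 𝕜) * diagonal (Pi.single i 1) *
    star (hA.eigenvectorUnitary : Matrix ι ι 𝕜), fun f => ?_⟩
  rw [cfc_eq_mul hA]
  simp_rw [fun i => (show f (hA.eigenvalues i) • ((hA.eigenvectorUnitary : Matrix ι ι 𝕜) *
    diagonal (Pi.single i 1) * star (hA.eigenvectorUnitary : Matrix ι ι 𝕜)) =
      (hA.eigenvectorUnitary : Matrix ι ι 𝕜) * (f (hA.eigenvalues i) • diagonal (Pi.single i 1)) *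
        star (hA.eigenvectorUnitary : Matrix ι ι 𝕜) by rw [mul_smul_comm, smul_mul_assoc])]
  rw [← Finset.sum_mul, ← Finset.mul_sum]
  congr 2
  ext i j
  rw [Matrix.sum_apply]
  by_cases h : i = j
  · subst h
    simp [Pi.single_apply, RCLike.real_smul_eq_coe_mul]
  · simp [h]

/-- The logarithm of a positive matrix. -/
def logm (A : Matrix ι ι 𝕜) : Matrix ι ι 𝕜 := cfc Real.log A

/-- The exponential of a Hermitian matrix. -/
def expm (A : Matrix ι ι 𝕜) : Matrix ι ι 𝕜 := cfc Real.exp A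

theorem continuousOn_spectrum (A : Matrix ι ι 𝕜) (f : ℝ → ℝ) : ContinuousOn f (spectrum ℝ A) :=
  (Matrix.finite_real_spectrum (A := A)).continuousOn f

theorem spectrum_pos {A : Matrix ι ι 𝕜} (hA : A.PosDef) {x : ℝ} (hx : x ∈ spectrum ℝ A) :
    0 < x := by
  rw [hA.isHermitian.spectrum_real_eq_range_eigenvalues] at hx
  obtain ⟨i, rfl⟩ := hx
  exact hA.eigenvalues_pos i

theorem rpow_eq_cfc {A : Matrix ι ι 𝕜} (hA : A.PosDef) (r : ℝ) :
    A ^ r = cfc (fun x : ℝ => x ^ r) A :=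
  CFC.rpow_eq_cfc_real hA.posSemidef.nonneg

theorem PosDef.rpow {A : Matrix ι ι 𝕜} (hA : A.PosDef) (r : ℝ) : (A ^ r).PosDef :=
  isStrictlyPositive_iff_posDef.1 (IsStrictlyPositive.rpow A r hA.isStrictlyPositive)

theorem rpow_add' {A : Matrix ι ι 𝕜} (hA : A.PosDef) (r s : ℝ) : A ^ (r + s) = A ^ r * A ^ s :=
  CFC.rpow_add hA.isUnit

theorem isHermitian_logm (A : Matrix ι ι 𝕜) : (logm A).IsHermitian := cfc_predicate _ A

theorem cfc_comp_matrix {A : Matrix ι ι 𝕜} (hA : A.IsHermitian) (g f : ℝ → ℝ) :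
    cfc g (cfc f A) = cfc (fun x => g (f x)) A :=
  (cfc_comp' g f A (((finite_real_spectrum (A := A)).image f).continuousOn g)
    (continuousOn_spectrum A f) hA.isSelfAdjoint).symm

theorem cfc_id_matrix {A : Matrix ι ι 𝕜} (hA : A.IsHermitian) : cfc (fun x : ℝ => x) A = A :=
  cfc_id' ℝ A hA.isSelfAdjoint

theorem cfc_one_matrix {A : Matrix ι ι 𝕜} (hA : A.IsHermitian) :
    cfc (fun _ : ℝ => (1 : ℝ)) A = 1 :=
  cfc_const_one ℝ A hA.isSelfAdjoint

theorem cfc_mul_matrix (A : Matrix ι ι 𝕜) (f g : ℝ → ℝ) :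
    cfc (fun x => f x * g x) A = cfc f A * cfc g A :=
  cfc_mul f g A (continuousOn_spectrum A f) (continuousOn_spectrum A g)

theorem logm_rpow {A : Matrix ι ι 𝕜} (hA : A.PosDef) (r : ℝ) : logm (A ^ r) = r • logm A := by
  rw [rpow_eq_cfc hA, logm, logm, cfc_comp_matrix hA.isHermitian,
    ← cfc_smul r Real.log A (continuousOn_spectrum A _)]
  exact cfc_congr fun x hx => Real.log_rpow (spectrum_pos hA hx) r

theorem expm_logm {A : Matrix ι ι 𝕜} (hA : A.PosDef) : expm (logm A) = A := by
  rw [expm, logm, cfc_comp_matrix hA.isHermitian]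
  conv_rhs => rw [← cfc_id_matrix hA.isHermitian]
  exact cfc_congr fun x hx => Real.exp_log (spectrum_pos hA hx)

theorem posDef_expm {H : Matrix ι ι 𝕜} (hH : H.IsHermitian) : (expm H).PosDef := by
  have h1 : (expm H).IsHermitian := cfc_predicate (p := IsSelfAdjoint) Real.exp H
  refine h1.posDef_iff_eigenvalues_pos.2 fun i => ?_
  have h2 := cfc_map_spectrum Real.exp H hH.isSelfAdjoint (continuousOn_spectrum H _)
  obtain ⟨x, -, hx⟩ := h2.subset (h1.eigenvalues_mem_spectrum_real i)
  exact hx ▸ Real.exp_pos x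

theorem rpow_neg_one {A : Matrix ι ι 𝕜} (hA : A.PosDef) : A ^ (-1 : ℝ) = A⁻¹ := by
  refine (inv_eq_left_inv ?_).symm
  have h := rpow_add' hA (-1) 1
  rw [CFC.rpow_one A hA.posSemidef.nonneg, neg_add_cancel,
    CFC.rpow_zero A hA.posSemidef.nonneg] at h
  exact h.symm

theorem rpow_neg_half_mul_self {A : Matrix ι ι 𝕜} (hA : A.PosDef) :
    A ^ (-(1 / 2) : ℝ) * A ^ (-(1 / 2) : ℝ) = A⁻¹ := by
  rw [← rpow_add' hA, ← rpow_neg_one hA]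
  norm_num

/-- The trace `tr (A⁻¹ Dᴴ B⁻¹ D)`, which for `A = B` is the Riemannian metric at `A`. -/
def traceForm (A B D : Matrix ι ι 𝕜) : ℝ := RCLike.re (A⁻¹ * Dᴴ * B⁻¹ * D).trace

/-- Cyclicity of the trace trades the fractional powers for inverses, for which continuity and
congruence invariance are evident. -/
theorem norm_sq_rpow_mul_mul {A B : Matrix ι ι 𝕜} (hA : A.PosDef) (hB : B.PosDef)
    (D : Matrix ι ι 𝕜) :
    ‖B ^ (-(1 / 2) : ℝ) * D * A ^ (-(1 / 2) : ℝ)‖ ^ 2 = traceForm A B D := by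
  rw [norm_sq_eq_trace, traceForm, ← rpow_neg_half_mul_self hA, ← rpow_neg_half_mul_self hB]
  simp only [conjTranspose_mul, (PosDef.rpow hA _).isHermitian.eq,
    (PosDef.rpow hB _).isHermitian.eq, mul_assoc]
  rw [trace_mul_comm (A ^ (-(1 / 2) : ℝ)) (A ^ (-(1 / 2) : ℝ) * _)]
  simp only [mul_assoc]

/-- With `x` half the difference of the logarithms, the right side is 2 |sinh x|, and |x| ≤ sinh
|x|. -/
theorem abs_log_sub_log_le {a b : ℝ} (ha : 0 < a) (hb : 0 < b) :
    |Real.log a - Real.log b| ≤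
      |a ^ (1 / 2 : ℝ) * b ^ (-(1 / 2) : ℝ) - a ^ (-(1 / 2) : ℝ) * b ^ (1 / 2 : ℝ)| := by
  set x := (Real.log a - Real.log b) / 2 with hx
  have h1 : a ^ (1 / 2 : ℝ) * b ^ (-(1 / 2) : ℝ) - a ^ (-(1 / 2) : ℝ) * b ^ (1 / 2 : ℝ) =
      2 * Real.sinh x := by
    rw [Real.rpow_def_of_pos ha, Real.rpow_def_of_pos hb, Real.rpow_def_of_pos ha,
      Real.rpow_def_of_pos hb, ← Real.exp_add, ← Real.exp_add, Real.sinh_eq]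
    rw [show Real.log a * (1 / 2) + Real.log b * -(1 / 2) = x by rw [hx]; ring,
      show Real.log a * -(1 / 2) + Real.log b * (1 / 2) = -x by rw [hx]; ring]
    ring
  rw [h1, show Real.log a - Real.log b = 2 * x by rw [hx]; ring, abs_mul, abs_mul]
  refine mul_le_mul_of_nonneg_left ?_ (abs_nonneg _)
  rw [Real.abs_sinh]
  exact Real.self_le_sinh_iff.2 (abs_nonneg x)

/-- The discrete exponential metric increasing inequality. -/
theorem norm_logm_sub_sq_le {A B : Matrix ι ι 𝕜} (hA : A.PosDef) (hB : B.PosDef) :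
    ‖logm B - logm A‖ ^ 2 ≤ traceForm A B (B - A) := by
  -- The right side is chosen because B^(1/2) A^(-1/2) - B^(-1/2) A^(1/2) = B^(-1/2) (B - A)
  -- A^(-1/2).
  have h := norm_cfc_sub_le hB.isHermitian hA.isHermitian Real.log (fun _ => 1) (fun _ => 1)
    Real.log (fun x => x ^ (1 / 2 : ℝ)) (fun x => x ^ (-(1 / 2) : ℝ)) (fun x => x ^ (-(1 / 2) : ℝ))
    (fun x => x ^ (1 / 2 : ℝ)) zero_le_one fun i j => by
      simpa using abs_log_sub_log_le (hB.eigenvalues_pos i) (hA.eigenvalues_pos j)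
  rw [← norm_sq_rpow_mul_mul hA hB]
  rw [cfc_one_matrix hA.isHermitian, cfc_one_matrix hB.isHermitian, mul_one, one_mul, one_mul,
    ← rpow_eq_cfc hA, ← rpow_eq_cfc hA, ← rpow_eq_cfc hB, ← rpow_eq_cfc hB] at h
  refine pow_le_pow_left₀ (norm_nonneg _) (h.trans_eq ?_) 2
  congr 1
  rw [mul_sub, sub_mul]
  congr 1
  · nth_rewrite 3 [← CFC.rpow_one B hB.posSemidef.nonneg]
    rw [← rpow_add' hB]
    norm_num
  · nth_rewrite 2 [← CFC.rpow_one A hA.posSemidef.nonneg]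
    rw [mul_assoc, ← rpow_add' hA]
    norm_num

theorem abs_eigenvalues_le_norm {H : Matrix ι ι 𝕜} (hH : H.IsHermitian) (i : ι) :
    |hH.eigenvalues i| ≤ ‖H‖ := by
  have hU : star (hH.eigenvectorUnitary : Matrix ι ι 𝕜) * (hH.eigenvectorUnitary : Matrix ι ι 𝕜)
    = 1 := Unitary.star_mul_self_of_mem hH.eigenvectorUnitary.2
  have h : star (hH.eigenvectorUnitary : Matrix ι ι 𝕜) * H *
      (hH.eigenvectorUnitary : Matrix ι ι 𝕜) =
        diagonal (fun i => ((hH.eigenvalues i : ℝ) : 𝕜)) := by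
    have h0 := (cfc_id_matrix hH).symm.trans (cfc_eq_mul hH _)
    calc _ = star (hH.eigenvectorUnitary : Matrix ι ι 𝕜) *
        ((hH.eigenvectorUnitary : Matrix ι ι 𝕜) *
          diagonal (fun i => ((hH.eigenvalues i : ℝ) : 𝕜)) *
            star (hH.eigenvectorUnitary : Matrix ι ι 𝕜)) *
          (hH.eigenvectorUnitary : Matrix ι ι 𝕜) := by rw [← h0]
      _ = _ := by
        simp only [mul_assoc, hU, mul_one]
        rw [← mul_assoc, hU, one_mul]
  rw [← sq_le_sq₀ (abs_nonneg _) (norm_nonneg _), ← norm_unitary_mul_mul hH.eigenvectorUnitary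
    hH.eigenvectorUnitary, h, norm_sq_eq_sum]
  have h1 := Finset.single_le_sum (f := fun k => ∑ j, ‖(diagonal (fun i =>
    ((hH.eigenvalues i : ℝ) : 𝕜)) : Matrix ι ι 𝕜) k j‖ ^ 2) (fun k _ => by positivity)
    (Finset.mem_univ i)
  have h2 := Finset.single_le_sum (f := fun j => ‖(diagonal (fun i =>
    ((hH.eigenvalues i : ℝ) : 𝕜)) : Matrix ι ι 𝕜) i j‖ ^ 2) (fun k _ => by positivity)
    (Finset.mem_univ i)
  refine le_trans ?_ (h2.trans h1)
  simp

theorem abs_exp_sub_exp_le {a b R : ℝ} (ha : a ≤ R) (hb : b ≤ R) :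
    |Real.exp a - Real.exp b| ≤ Real.exp R * |a - b| := by
  wlog hab : b ≤ a generalizing a b
  · rw [abs_sub_comm, abs_sub_comm a]
    exact this hb ha (le_of_not_ge hab)
  rw [abs_of_nonneg (by simpa using hab), abs_of_nonneg (by linarith)]
  have h1 := Real.add_one_le_exp (b - a)
  have h2 : Real.exp b = Real.exp a * Real.exp (b - a) := by rw [← Real.exp_add]; ring_nf
  have h3 := Real.exp_le_exp.2 ha
  nlinarith [Real.exp_pos a]

/-- Local Lipschitz continuity carries estimates on logarithms back to the matrices: it gives
compactness for the existence of the mean, and convergence of matrices from convergence in `dist`.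
-/
theorem norm_expm_sub_le {H K : Matrix ι ι 𝕜} (hH : H.IsHermitian) (hK : K.IsHermitian) {R : ℝ}
    (hHR : ‖H‖ ≤ R) (hKR : ‖K‖ ≤ R) : ‖expm H - expm K‖ ≤ Real.exp R * ‖H - K‖ := by
  have h := norm_cfc_sub_le hH hK Real.exp (fun _ => 1) (fun _ => 1)
    Real.exp (fun x => x) (fun _ => 1) (fun _ => 1) (fun x => x) (Real.exp_pos R).le fun i j => by
      simpa using abs_exp_sub_exp_le
        ((le_abs_self _).trans ((abs_eigenvalues_le_norm hH i).trans hHR))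
        ((le_abs_self _).trans ((abs_eigenvalues_le_norm hK j).trans hKR))
  rwa [cfc_one_matrix hH, cfc_one_matrix hK, mul_one, one_mul, mul_one, one_mul, cfc_id_matrix hH,
    cfc_id_matrix hK] at h

/-! ### Congruence invariance of the distance -/

theorem tendsto_traceForm {X : Type*} {l : Filter X} {A B D : X → Matrix ι ι 𝕜}
    {A₀ B₀ D₀ : Matrix ι ι 𝕜} (hA₀ : A₀.PosDef) (hB₀ : B₀.PosDef) (hA : Tendsto A l (𝓝 A₀))
    (hB : Tendsto B l (𝓝 B₀)) (hD : Tendsto D l (𝓝 D₀)) :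
    Tendsto (fun x => traceForm (A x) (B x) (D x)) l (𝓝 (traceForm A₀ B₀ D₀)) := by
  have inv {A : X → Matrix ι ι 𝕜} {A₀ : Matrix ι ι 𝕜} (hA₀ : A₀.PosDef)
      (hA : Tendsto A l (𝓝 A₀)) : Tendsto (fun x => (A x)⁻¹) l (𝓝 A₀⁻¹) := by
    simp only [Matrix.inv_def, Ring.inverse_eq_inv']
    refine Tendsto.smul (Tendsto.inv₀ ?_ hA₀.det_pos.ne') ?_
    · exact ((continuous_id.matrix_det).tendsto A₀).comp hA
    · exact ((continuous_id.matrix_adjugate).tendsto A₀).comp hA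
  have hD' : Tendsto (fun x => (D x)ᴴ) l (𝓝 D₀ᴴ) :=
    ((continuous_id.matrix_conjTranspose).tendsto D₀).comp hD
  have h := (((inv hA₀ hA).mul hD').mul (inv hB₀ hB)).mul hD
  exact (RCLike.continuous_re.tendsto _).comp
    (((continuous_id.matrix_trace).tendsto (A₀⁻¹ * D₀ᴴ * B₀⁻¹ * D₀)).comp h)

theorem conj_posDef {A X : Matrix ι ι 𝕜} (hA : A.PosDef) (hX : IsUnit X) : (X * A * Xᴴ).PosDef := by
  exact (Matrix.IsUnit.posDef_star_right_conjugate_iff hX).2 hA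

theorem traceForm_conj {A B D X : Matrix ι ι 𝕜} (hX : IsUnit X) :
    traceForm (X * A * Xᴴ) (X * B * Xᴴ) (X * D * Xᴴ) = traceForm A B D := by
  have h1 : X⁻¹ * X = 1 := nonsing_inv_mul X ((isUnit_iff_isUnit_det X).1 hX)
  have h2 : Xᴴ * (Xᴴ)⁻¹ = 1 := by rw [← conjTranspose_nonsing_inv, ← conjTranspose_mul, h1,
    conjTranspose_one]
  have e1 (M : Matrix ι ι 𝕜) : X⁻¹ * (X * M) = M := by rw [← mul_assoc, h1, one_mul]
  have e2 (M : Matrix ι ι 𝕜) : Xᴴ * ((Xᴴ)⁻¹ * M) = M := by rw [← mul_assoc, h2, one_mul]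
  simp only [traceForm, conjTranspose_mul, conjTranspose_conjTranspose, Matrix.mul_inv_rev, mul_assoc, e1,
    e2]
  rw [trace_mul_comm (Xᴴ)⁻¹]
  simp only [mul_assoc, h2, mul_one]

/-- The Riemannian norm of a tangent vector. -/
def speed (A D : Matrix ι ι 𝕜) : ℝ := ‖A ^ (-(1 / 2) : ℝ) * D * A ^ (-(1 / 2) : ℝ)‖

theorem speed_eq_sqrt {A : Matrix ι ι 𝕜} (hA : A.PosDef) (D : Matrix ι ι 𝕜) :
    speed A D = √(traceForm A A D) := by
  rw [← norm_sq_rpow_mul_mul hA hA, Real.sqrt_sq (norm_nonneg _), speed]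

theorem speed_conj {A X : Matrix ι ι 𝕜} (hA : A.PosDef) (hX : IsUnit X) (D : Matrix ι ι 𝕜) :
    speed (X * A * Xᴴ) (X * D * Xᴴ) = speed A D := by
  rw [speed_eq_sqrt hA, speed_eq_sqrt (conj_posDef hA hX), traceForm_conj hX]

/-- Congruence by `X` as a linear map. -/
def conjL (X : Matrix ι ι 𝕜) : Matrix ι ι 𝕜 →L[ℝ] Matrix ι ι 𝕜 :=
  LinearMap.toContinuousLinearMap
    { toFun := fun A => X * A * Xᴴ
      map_add' := fun A B => by rw [mul_add, add_mul]
      map_smul' := fun r A => by rw [RingHom.id_apply, mul_smul_comm, smul_mul_assoc] }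

theorem conj_inv_conj {X : Matrix ι ι 𝕜} (hX : IsUnit X) (A : Matrix ι ι 𝕜) :
    X⁻¹ * (X * A * Xᴴ) * (X⁻¹)ᴴ = A := by
  have h1 : X⁻¹ * X = 1 := nonsing_inv_mul X ((isUnit_iff_isUnit_det X).1 hX)
  have h2 : Xᴴ * (X⁻¹)ᴴ = 1 := by rw [← conjTranspose_mul, h1, conjTranspose_one]
  simp only [mul_assoc, h2, mul_one]
  rw [← mul_assoc, h1, one_mul]

theorem deriv_conj {X : Matrix ι ι 𝕜} (hX : IsUnit X) (α : ℝ → Matrix ι ι 𝕜) (s : ℝ) :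
    deriv (fun s => X * α s * Xᴴ) s = X * deriv α s * Xᴴ := by
  by_cases h : DifferentiableAt ℝ α s
  · exact ((conjL X).hasFDerivAt.comp_hasDerivAt s h.hasDerivAt).deriv
  -- Where `α` is not differentiable, `deriv` has the default value 0; since the congruence is
  -- invertible, the transformed path is not differentiable there either.
  · have h' : ¬ DifferentiableAt ℝ (fun s => X * α s * Xᴴ) s := fun h' => h <| by
      have := (conjL X⁻¹).differentiableAt.comp s h'
      refine this.congr_of_eventuallyEq (Eventually.of_forall fun r => ?_)
      exact (conj_inv_conj hX (α r)).symm
    have e : deriv α s = 0 := deriv_zero_of_not_differentiableAt h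
    have e' : deriv (fun s => X * α s * Xᴴ) s = 0 := deriv_zero_of_not_differentiableAt h'
    rw [e, e', mul_zero, zero_mul]

theorem isPiecewiseSmoothPath_conj {X : Matrix ι ι 𝕜} (hX : IsUnit X) {a b : ℝ}
    {α : ℝ → Matrix ι ι 𝕜} (h : IsPiecewiseSmoothPath a b α) :
    IsPiecewiseSmoothPath a b (fun s => X * α s * Xᴴ) := by
  obtain ⟨h1, h2, N, t, ht, h0, hN, hs⟩ := h
  refine ⟨(conjL X).continuous.comp_continuousOn h1, fun s hs => conj_posDef (h2 s hs) hX,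
    N, t, ht, h0, hN, fun i hi => (conjL X).contDiff.comp_contDiffOn (hs i hi)⟩

theorem pathLength_conj {X : Matrix ι ι 𝕜} (hX : IsUnit X) {a b : ℝ} (hab : a ≤ b)
    {α : ℝ → Matrix ι ι 𝕜} (h : IsPiecewiseSmoothPath a b α) :
    pathLength a b (fun s => X * α s * Xᴴ) = pathLength a b α := by
  refine intervalIntegral.integral_congr fun s hs => ?_
  rw [uIcc_of_le hab] at hs
  exact (congrArg (speed _) (deriv_conj hX α s)).trans (speed_conj (h.2.1 s hs) hX _)

/-- Congruence maps connecting paths to connecting paths of the same length, and the inverse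
congruence maps them back, so the two sets of lengths coincide. -/
theorem dist_conj {X : Matrix ι ι 𝕜} (hX : IsUnit X) (A B : Matrix ι ι 𝕜) :
    dist (X * A * Xᴴ) (X * B * Xᴴ) = dist A B := by
  have key {X : Matrix ι ι 𝕜} (hX : IsUnit X) (A B : Matrix ι ι 𝕜) (ℓ : ℝ)
      (h : ∃ (a b : ℝ) (α : ℝ → Matrix ι ι 𝕜), a < b ∧ IsPiecewiseSmoothPath a b α ∧
        α a = A ∧ α b = B ∧ ℓ = pathLength a b α) :
      ∃ (a b : ℝ) (α : ℝ → Matrix ι ι 𝕜), a < b ∧ IsPiecewiseSmoothPath a b α ∧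
        α a = X * A * Xᴴ ∧ α b = X * B * Xᴴ ∧ ℓ = pathLength a b α := by
    obtain ⟨a, b, α, hab, hα, rfl, rfl, rfl⟩ := h
    exact ⟨a, b, fun s => X * α s * Xᴴ, hab, isPiecewiseSmoothPath_conj hX hα, rfl, rfl,
      (pathLength_conj hX hab.le hα).symm⟩
  rw [dist, dist]
  congr 1
  ext ℓ
  refine ⟨fun h => ?_, key hX A B ℓ⟩
  have h' := key (X := X⁻¹) ((isUnit_nonsing_inv_iff).2 hX) _ _ ℓ h
  rwa [conj_inv_conj hX, conj_inv_conj hX] at h'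

theorem pathLength_nonneg {a b : ℝ} (hab : a ≤ b) (α : ℝ → Matrix ι ι 𝕜) : 0 ≤ pathLength a b α :=
  intervalIntegral.integral_nonneg hab fun _ _ => norm_nonneg _

theorem dist_le_pathLength {a b : ℝ} (hab : a < b) {α : ℝ → Matrix ι ι 𝕜}
    (h : IsPiecewiseSmoothPath a b α) : dist (α a) (α b) ≤ pathLength a b α := by
  refine csInf_le ⟨0, ?_⟩ ⟨a, b, α, hab, h, rfl, rfl, rfl⟩
  rintro _ ⟨a, b, α, hab, -, -, -, rfl⟩
  exact pathLength_nonneg hab.le α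

/-! ### The path of powers -/

/-- The path of powers of `Z` from `Z ^ p` to `Z ^ q`. -/
def powPath (Z : Matrix ι ι 𝕜) (p q s : ℝ) : Matrix ι ι 𝕜 := Z ^ (p + s * (q - p))

theorem contDiff_powPath {Z : Matrix ι ι 𝕜} (hZ : Z.PosDef) (p q : ℝ) :
    ContDiff ℝ ∞ (powPath Z p q) := by
  obtain ⟨P, hP⟩ := exists_cfc_eq_sum hZ.isHermitian
  have h : powPath Z p q = fun s => ∑ i, (hZ.isHermitian.eigenvalues i) ^ (p + s * (q - p)) • P i :=
    funext fun s => by rw [powPath, rpow_eq_cfc hZ, hP]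
  rw [h]
  refine ContDiff.sum fun i _ => ContDiff.fun_smul ?_ contDiff_const
  have := hZ.eigenvalues_pos i
  simp only [Real.rpow_def_of_pos this]
  fun_prop

theorem hasDerivAt_powPath {Z : Matrix ι ι 𝕜} (hZ : Z.PosDef) (p q s : ℝ) :
    HasDerivAt (powPath Z p q)
      (cfc (fun x => x ^ (p + s * (q - p)) * ((q - p) * Real.log x)) Z) s := by
  obtain ⟨P, hP⟩ := exists_cfc_eq_sum hZ.isHermitian
  have h : powPath Z p q = fun s => ∑ i, (hZ.isHermitian.eigenvalues i) ^ (p + s * (q - p)) • P i :=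
    funext fun s => by rw [powPath, rpow_eq_cfc hZ, hP]
  rw [h, hP]
  refine HasDerivAt.fun_sum fun i _ => HasDerivAt.smul_const ?_ _
  have h1 : HasDerivAt (fun s : ℝ => p + s * (q - p)) (q - p) s := by
    simpa using ((hasDerivAt_id s).mul_const (q - p)).const_add p
  exact (h1.const_rpow (hZ.eigenvalues_pos i)).congr_deriv (by ring)

/-- All matrices involved are functions of `Z`, so the computation is scalar and the speed does not
depend on `s`. -/
theorem speed_powPath {Z : Matrix ι ι 𝕜} (hZ : Z.PosDef) (p q s : ℝ) :
    speed (powPath Z p q s) (deriv (powPath Z p q) s) = |q - p| * ‖logm Z‖ := by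
  have hd : deriv (powPath Z p q) s =
      cfc (fun x => x ^ (p + s * (q - p)) * ((q - p) * Real.log x)) Z :=
    (hasDerivAt_powPath hZ p q s).deriv
  rw [hd, speed, powPath, rpow_eq_cfc (PosDef.rpow hZ _),
    rpow_eq_cfc hZ, cfc_comp_matrix hZ.isHermitian, ← cfc_mul_matrix, ← cfc_mul_matrix,
    ← Real.norm_eq_abs, ← norm_smul, logm, ← cfc_smul _ _ _ (continuousOn_spectrum Z _)]
  congr 1
  refine cfc_congr fun x hx => ?_
  have hx := spectrum_pos hZ hx
  set r := p + s * (q - p)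
  have h : (x ^ r) ^ (-(1 / 2) : ℝ) * (x ^ r) ^ (-(1 / 2) : ℝ) * x ^ r = 1 := by
    rw [← Real.rpow_add (by positivity), ← Real.rpow_add_one (by positivity)]
    norm_num
  simp only [smul_eq_mul]
  linear_combination ((q - p) * Real.log x) * h

theorem isPiecewiseSmoothPath_powPath {Z : Matrix ι ι 𝕜} (hZ : Z.PosDef) (p q : ℝ) :
    IsPiecewiseSmoothPath 0 1 (powPath Z p q) :=
  ⟨(contDiff_powPath hZ p q).continuous.continuousOn, fun _ _ => PosDef.rpow hZ _, 1,
    fun n => n, Nat.mono_cast, by simp, by simp,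
    fun _ _ => (contDiff_powPath hZ p q).contDiffOn⟩

theorem pathLength_powPath {Z : Matrix ι ι 𝕜} (hZ : Z.PosDef) (p q : ℝ) :
    pathLength 0 1 (powPath Z p q) = |q - p| * ‖logm Z‖ := by
  refine (intervalIntegral.integral_congr fun s _ => speed_powPath hZ p q s).trans ?_
  simp

theorem dist_rpow_le {Z : Matrix ι ι 𝕜} (hZ : Z.PosDef) (p q : ℝ) :
    dist (Z ^ p) (Z ^ q) ≤ |q - p| * ‖logm Z‖ := by
  have h := dist_le_pathLength zero_lt_one (isPiecewiseSmoothPath_powPath hZ p q)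
  rw [pathLength_powPath hZ] at h
  simpa [powPath] using h

/-- Two positive matrices are simultaneously congruent to `1` and a positive matrix. -/
theorem exists_conj {A B : Matrix ι ι 𝕜} (hA : A.PosDef) (hB : B.PosDef) :
    ∃ S Z : Matrix ι ι 𝕜, S.PosDef ∧ Z.PosDef ∧ S * Z ^ (0 : ℝ) * Sᴴ = A ∧
      S * Z ^ (1 : ℝ) * Sᴴ = B ∧ ∀ t, S * Z ^ t * Sᴴ = geodesic A B t := by
  have hS := PosDef.rpow hA (1 / 2)
  have hT := PosDef.rpow hA (-(1 / 2))
  have hZ : (A ^ (-(1 / 2) : ℝ) * B * A ^ (-(1 / 2) : ℝ)).PosDef := by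
    have := conj_posDef hB hT.isUnit
    rwa [hT.isHermitian.eq] at this
  have e0 := CFC.rpow_zero A hA.posSemidef.nonneg
  have e1 : A ^ (1 / 2 : ℝ) * A ^ (-(1 / 2) : ℝ) = 1 := by
    rw [← rpow_add' hA, add_neg_cancel, e0]
  have e2 : A ^ (-(1 / 2) : ℝ) * A ^ (1 / 2 : ℝ) = 1 := by
    rw [← rpow_add' hA, neg_add_cancel, e0]
  -- The witnesses are A^(1/2) and A^(-1/2) B A^(-1/2). Writing the endpoints as powers 0 and 1 puts
  -- them on the same footing as the other points of the geodesic.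
  refine ⟨_, _, hS, hZ, ?_, ?_, fun t => ?_⟩
  · rw [CFC.rpow_zero _ hZ.posSemidef.nonneg, mul_one, hS.isHermitian.eq, ← rpow_add' hA]
    norm_num
    exact CFC.rpow_one A hA.posSemidef.nonneg
  · rw [CFC.rpow_one _ hZ.posSemidef.nonneg, hS.isHermitian.eq]
    simp only [mul_assoc, e2, mul_one]
    rw [← mul_assoc, e1, one_mul]
  · rw [hS.isHermitian.eq, geodesic]

/-! ### The exponential metric increasing inequality -/

theorem norm_logm_sub_le_sqrt {A B : Matrix ι ι 𝕜} (hA : A.PosDef) (hB : B.PosDef) :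
    ‖logm B - logm A‖ ≤ √(traceForm A B (B - A)) := by
  rw [← Real.sqrt_sq (norm_nonneg (logm B - logm A))]
  exact Real.sqrt_le_sqrt (norm_logm_sub_sq_le hA hB)

theorem tendsto_sqrt_traceForm_sub {X : Type*} {l : Filter X} {B : X → Matrix ι ι 𝕜}
    {C : Matrix ι ι 𝕜} (hC : C.PosDef) (hB : Tendsto B l (𝓝 C)) :
    Tendsto (fun x => √(traceForm C (B x) (B x - C))) l (𝓝 0) := by
  have hsub : Tendsto (fun x => B x - C) l (𝓝 (C - C)) := hB.sub tendsto_const_nhds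
  have h := (tendsto_traceForm hC hC tendsto_const_nhds hB hsub).sqrt
  rwa [sub_self, show traceForm C C 0 = 0 by simp [traceForm], Real.sqrt_zero] at h

/-- Continuity of the matrix logarithm is itself a consequence of the discrete inequality, whose
right side vanishes in the limit. -/
theorem continuousOn_logm_comp {α : ℝ → Matrix ι ι 𝕜} {s : Set ℝ} (hα : ContinuousOn α s)
    (hpos : ∀ x ∈ s, (α x).PosDef) : ContinuousOn (fun x => logm (α x)) s := by
  intro x hx
  have h2 : Tendsto (fun y => ‖logm (α y) - logm (α x)‖) (𝓝[s] x) (𝓝 0) := by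
    refine squeeze_zero' (Eventually.of_forall fun _ => norm_nonneg _) ?_
      (tendsto_sqrt_traceForm_sub (hpos x hx) (hα x hx))
    filter_upwards [self_mem_nhdsWithin] with y hy
    exact norm_logm_sub_le_sqrt (hpos x hx) (hpos y hy)
  exact tendsto_iff_norm_sub_tendsto_zero.2 h2

theorem traceForm_smul (A B D : Matrix ι ι 𝕜) (r : ℝ) :
    traceForm A B (r • D) = r ^ 2 * traceForm A B D := by
  simp only [traceForm, conjTranspose_smul, star_trivial, mul_smul_comm, smul_mul_assoc,
    trace_smul, RCLike.smul_re]
  ring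

/-- The difference quotients of `logm ∘ α` at `x` are bounded by the square root of `traceForm` at
the slope of `α`, which tends to the speed. A comparison theorem for right slopes integrates this
bound. -/
theorem norm_logm_sub_le_integral {u v : ℝ} (huv : u ≤ v) {α : ℝ → Matrix ι ι 𝕜}
    (hα : ContDiffOn ℝ ∞ α (Icc u v)) (hpos : ∀ x ∈ Icc u v, (α x).PosDef) :
    IntervalIntegrable (fun s => speed (α s) (deriv α s)) volume u v ∧
      ‖logm (α v) - logm (α u)‖ ≤ ∫ s in u..v, speed (α s) (deriv α s) := by
  rcases huv.eq_or_lt with rfl | huv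
  · simp
  set D := derivWithin α (Icc u v) with hDdef
  have hD : ContinuousOn D (Icc u v) :=
    hα.continuousOn_derivWithin (uniqueDiffOn_Icc huv) (by simp)
  have hG : ContinuousOn (fun s => speed (α s) (D s)) (Icc u v) := by
    refine ContinuousOn.congr (f := fun s => √(traceForm (α s) (α s) (D s))) (fun x hx => ?_)
      fun x hx => speed_eq_sqrt (hpos x hx) _
    exact (tendsto_traceForm (hpos x hx) (hpos x hx) (hα.continuousOn x hx) (hα.continuousOn x hx)
      (hD x hx)).sqrt
  have heq : EqOn (fun s => speed (α s) (D s)) (fun s => speed (α s) (deriv α s)) (Ioo u v) := by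
    intro s hs
    have : D s = deriv α s := derivWithin_of_mem_nhds (Icc_mem_nhds hs.1 hs.2)
    simp only [this]
  have hae : (fun s => speed (α s) (D s)) =ᵐ[volume.restrict (uIoc u v)]
      fun s => speed (α s) (deriv α s) := by
    rw [uIoc_of_le huv.le, ← restrict_Ioo_eq_restrict_Ioc]
    exact (ae_restrict_mem measurableSet_Ioo).mono fun s hs => heq hs
  refine ⟨(hG.intervalIntegrable_of_Icc huv.le).congr_ae hae, ?_⟩
  -- The speed computed with `derivWithin` is continuous on the closed interval and agrees with the
  -- integrand inside; extended to the line, it has a differentiable primitive.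
  set G := IccExtend huv.le ((Icc u v).domRestrict fun s => speed (α s) (D s)) with hGdef
  have hGc : Continuous G := continuous_IccExtend_iff.2 hG.domRestrict
  have hGeq : ∀ s ∈ Icc u v, G s = speed (α s) (D s) := fun s hs => IccExtend_of_mem _ _ hs
  have hint : ∫ s in u..v, speed (α s) (deriv α s) = ∫ s in u..v, G s := by
    rw [← intervalIntegral.integral_congr_ae_restrict hae]
    refine intervalIntegral.integral_congr fun s hs => ?_
    rw [uIcc_of_le huv.le] at hs
    exact (hGeq s hs).symm
  rw [hint]
  -- The comparison theorem needs a strict inequality between the derivatives, which the extra slope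
  -- `ε` provides.
  have key : ∀ ε > 0, ‖logm (α v) - logm (α u)‖ ≤ (∫ s in u..v, G s) + ε * (v - u) := by
    intro ε hε
    have hB (x : ℝ) : HasDerivAt (fun x => (∫ s in u..x, G s) + ε * (x - u)) (G x + ε) x := by
      have h1 := hGc.integral_hasStrictDerivAt u x
      have h2 := ((hasDerivAt_id x).sub_const u).const_mul ε
      rw [mul_one] at h2
      exact h1.hasDerivAt.add h2
    refine image_norm_le_of_liminf_right_slope_norm_lt_deriv_boundary
      (f := fun s => logm (α s) - logm (α u)) (f' := G)
      ((continuousOn_logm_comp hα.continuousOn hpos).sub continuousOn_const) ?_ (by simp)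
      (fun x _ => (hB x).continuousAt.continuousWithinAt) (fun x _ => (hB x).hasDerivWithinAt)
      (fun x _ _ => by linarith) (right_mem_Icc.2 huv.le)
    intro x hx r hr
    have hxI : x ∈ Icc u v := Ico_subset_Icc_self hx
    have hle : 𝓝[>] x ≤ 𝓝[Icc u v] x := by
      rw [← nhdsWithin_Ioo_eq_nhdsGT hx.2]
      exact nhdsWithin_mono _ fun y hy => ⟨hx.1.trans hy.1.le, hy.2.le⟩
    have hmem : ∀ᶠ z in 𝓝[>] x, z ∈ Ioo x v := Ioo_mem_nhdsGT hx.2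
    have hd : HasDerivWithinAt α (D x) (Icc u v) x :=
      ((hα.differentiableOn (by simp)) x hxI).hasDerivWithinAt
    have hslope : Tendsto (slope α x) (𝓝[>] x) (𝓝 (D x)) := by
      have h1 := hasDerivWithinAt_iff_tendsto_slope.1 hd
      refine h1.mono_left (le_inf (hle.trans inf_le_left) ?_)
      rw [le_principal_iff]
      filter_upwards [hmem] with z hz
      exact ⟨⟨hx.1.trans hz.1.le, hz.2.le⟩, hz.1.ne'⟩
    have hcont : Tendsto α (𝓝[>] x) (𝓝 (α x)) := (hα.continuousOn x hxI).mono_left hle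
    have hlim := (tendsto_traceForm (hpos x hxI) (hpos x hxI) tendsto_const_nhds hcont hslope).sqrt
    rw [← speed_eq_sqrt (hpos x hxI), ← hGeq x hxI] at hlim
    refine Eventually.frequently ?_
    filter_upwards [hlim.eventually_lt_const hr, hmem] with z hz hzm
    refine lt_of_le_of_lt ?_ hz
    have hzx : 0 < z - x := sub_pos.2 hzm.1
    have hzI : z ∈ Icc u v := ⟨hx.1.trans hzm.1.le, hzm.2.le⟩
    have hs : √(traceForm (α x) (α z) (slope α x z)) =
        (z - x)⁻¹ * √(traceForm (α x) (α z) (α z - α x)) := by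
      change √(traceForm (α x) (α z) ((z - x)⁻¹ • (α z - α x))) = _
      rw [traceForm_smul, Real.sqrt_mul (sq_nonneg _), Real.sqrt_sq (inv_nonneg.2 hzx.le)]
    rw [hs, slope_def_module, smul_eq_mul]
    refine mul_le_mul_of_nonneg_left ?_ (inv_nonneg.2 hzx.le)
    refine le_trans ?_ (norm_logm_sub_le_sqrt (hpos x hxI) (hpos z hzI))
    refine (norm_sub_norm_le _ _).trans_eq ?_
    simp
  have hlim : Tendsto (fun ε => (∫ s in u..v, G s) + ε * (v - u)) (𝓝[>] 0)
      (𝓝 ((∫ s in u..v, G s) + 0 * (v - u))) :=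
    (Continuous.tendsto (by fun_prop) 0).mono_left nhdsWithin_le_nhds
  rw [zero_mul, add_zero] at hlim
  refine ge_of_tendsto hlim ?_
  filter_upwards [self_mem_nhdsWithin] with ε hε using key ε hε

theorem norm_logm_sub_le_pathLength {a b : ℝ} {α : ℝ → Matrix ι ι 𝕜}
    (h : IsPiecewiseSmoothPath a b α) : ‖logm (α b) - logm (α a)‖ ≤ pathLength a b α := by
  obtain ⟨-, hpos, N, t, ht, rfl, rfl, hs⟩ := h
  have hpiece (i : ℕ) (hi : i < N) := norm_logm_sub_le_integral (ht i.le_succ) (hs i hi)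
    fun x hx => hpos x ⟨(ht i.zero_le).trans hx.1, hx.2.trans (ht hi)⟩
  have hsum := intervalIntegral.sum_integral_adjacent_intervals (n := N)
    fun i hi => (hpiece i hi).1
  have htel := Finset.sum_range_sub (fun i => logm (α (t i))) N
  change _ ≤ ∫ s in t 0..t N, speed (α s) (deriv α s)
  rw [← hsum, ← htel]
  exact (norm_sum_le _ _).trans (Finset.sum_le_sum fun i hi => (hpiece i (Finset.mem_range.1 hi)).2)

/-! ### The distance -/

theorem dist_nonneg' (A B : Matrix ι ι 𝕜) : 0 ≤ dist A B := by
  refine Real.sInf_nonneg ?_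
  rintro _ ⟨a, b, α, hab, -, -, -, rfl⟩
  exact pathLength_nonneg hab.le α

theorem norm_logm_sub_le_dist {A B : Matrix ι ι 𝕜} (hA : A.PosDef) (hB : B.PosDef) :
    ‖logm B - logm A‖ ≤ dist A B := by
  refine le_csInf ?_ ?_
  -- A connecting path must be exhibited, since the infimum of the empty set would be 0.
  · obtain ⟨S, Z, hS, hZ, h0, h1, -⟩ := exists_conj hA hB
    refine ⟨_, 0, 1, _, zero_lt_one,
      isPiecewiseSmoothPath_conj hS.isUnit (isPiecewiseSmoothPath_powPath hZ 0 1), ?_, ?_, rfl⟩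
    · simpa [powPath] using h0
    · simpa [powPath] using h1
  · rintro _ ⟨a, b, α, -, hα, rfl, rfl, rfl⟩
    exact norm_logm_sub_le_pathLength hα

/-- The length of the path of powers equals the lower bound by logarithms, so this path is shortest.
-/
theorem dist_rpow {Z : Matrix ι ι 𝕜} (hZ : Z.PosDef) (p q : ℝ) :
    dist (Z ^ p) (Z ^ q) = |q - p| * ‖logm Z‖ := by
  refine (dist_rpow_le hZ p q).antisymm ?_
  have h := norm_logm_sub_le_dist (PosDef.rpow hZ p) (PosDef.rpow hZ q)
  rwa [logm_rpow hZ, logm_rpow hZ, ← sub_smul, norm_smul, Real.norm_eq_abs] at h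

theorem dist_one_right {Z : Matrix ι ι 𝕜} (hZ : Z.PosDef) : dist Z 1 = ‖logm Z‖ := by
  have h := dist_rpow hZ 1 0
  rwa [CFC.rpow_one Z hZ.posSemidef.nonneg, CFC.rpow_zero Z hZ.posSemidef.nonneg, zero_sub,
    abs_neg, abs_one, one_mul] at h

theorem dist_comm' {A B : Matrix ι ι 𝕜} (hA : A.PosDef) (hB : B.PosDef) :
    dist A B = dist B A := by
  obtain ⟨S, Z, hS, hZ, rfl, rfl, -⟩ := exists_conj hA hB
  rw [dist_conj hS.isUnit, dist_conj hS.isUnit, dist_rpow hZ, dist_rpow hZ, abs_sub_comm]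

theorem dist_self' {A : Matrix ι ι 𝕜} (hA : A.PosDef) : dist A A = 0 := by
  have h := dist_rpow hA 1 1
  rwa [CFC.rpow_one A hA.posSemidef.nonneg, sub_self, abs_zero, zero_mul] at h

theorem eq_of_dist_eq_zero' {A B : Matrix ι ι 𝕜} (hA : A.PosDef) (hB : B.PosDef)
    (h : dist A B = 0) : A = B := by
  have h1 := norm_logm_sub_le_dist hA hB
  rw [h, norm_le_zero_iff, sub_eq_zero] at h1
  rw [← expm_logm hA, ← expm_logm hB, h1]

/-! ### Nonpositive curvature of the positive cone -/

theorem geodesic_posDef {A B : Matrix ι ι 𝕜} (hA : A.PosDef) (hB : B.PosDef) (t : ℝ) :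
    (geodesic A B t).PosDef := by
  obtain ⟨S, Z, hS, hZ, -, -, h⟩ := exists_conj hA hB
  rw [← h]
  exact conj_posDef (PosDef.rpow hZ t) hS.isUnit

/-- Stewart's identity in the Frobenius norm, for the point `c` and the segment from `-t • h` to `(1
- t) • h`, which 0 divides in the ratio `t : 1 - t`. -/
theorem norm_sq_comparison (c h : Matrix ι ι 𝕜) (t : ℝ) :
    ‖c‖ ^ 2 = (1 - t) * ‖c + t • h‖ ^ 2 + t * ‖c - (1 - t) • h‖ ^ 2 - t * (1 - t) * ‖h‖ ^ 2 := by
  simp only [norm_sq_eq_sum, Finset.mul_sum, ← Finset.sum_add_distrib, ← Finset.sum_sub_distrib]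
  refine Finset.sum_congr rfl fun i _ => Finset.sum_congr rfl fun j _ => ?_
  simp only [Matrix.add_apply, Matrix.sub_apply, Matrix.smul_apply, RCLike.norm_sq_eq_def, map_add,
    map_sub, RCLike.smul_re, RCLike.smul_im]
  ring

/-- Once the geodesic point is moved to 1, its distance to `C` and the distance of the endpoints are
exact norms of logarithms, while the distances from `C` to the endpoints are at least such norms.
The errors therefore go in the right direction in Stewart's identity. -/
theorem dist_geodesic_sq_le {A B C : Matrix ι ι 𝕜} (hA : A.PosDef) (hB : B.PosDef) (hC : C.PosDef)
    {t : ℝ} (ht : t ∈ Icc (0 : ℝ) 1) : dist C (geodesic A B t) ^ 2 ≤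
      (1 - t) * dist C A ^ 2 + t * dist C B ^ 2 - t * (1 - t) * dist A B ^ 2 := by
  obtain ⟨S, Z, hS, hZ, rfl, rfl, hg⟩ := exists_conj hA hB
  rw [← hg]
  have hW := PosDef.rpow hZ (-(t / 2))
  -- Congruence by `X` shifts the exponent of `Z` by `-t`: the geodesic point becomes 1, the
  -- endpoints Z^(-t) and Z^(1 - t).
  set X := Z ^ (-(t / 2)) * S⁻¹ with hXdef
  have hX : IsUnit X := hW.isUnit.mul ((isUnit_nonsing_inv_iff).2 hS.isUnit)
  have hconj (p : ℝ) : X * (S * Z ^ p * Sᴴ) * Xᴴ = Z ^ (p - t) := by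
    have h1 := conj_inv_conj hS.isUnit (Z ^ p)
    rw [hXdef, conjTranspose_mul, hW.isHermitian.eq]
    calc _ = Z ^ (-(t / 2)) * (S⁻¹ * (S * Z ^ p * Sᴴ) * (S⁻¹)ᴴ) * Z ^ (-(t / 2)) := by
          simp only [mul_assoc]
      _ = _ := by
          rw [h1, ← rpow_add' hZ, ← rpow_add' hZ]
          congr 1
          ring
  have hC' := conj_posDef hC hX
  rw [dist_conj hS.isUnit, dist_rpow hZ, ← dist_conj hX C, ← dist_conj hX C, ← dist_conj hX C,
    hconj, hconj, hconj, sub_self, CFC.rpow_zero Z hZ.posSemidef.nonneg, dist_one_right hC']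
  set C' := X * C * Xᴴ
  have h0 := norm_logm_sub_le_dist (PosDef.rpow hZ (0 - t)) hC'
  have h1 := norm_logm_sub_le_dist (PosDef.rpow hZ (1 - t)) hC'
  rw [logm_rpow hZ] at h0 h1
  rw [dist_comm' (PosDef.rpow hZ _) hC'] at h0 h1
  rw [zero_sub, neg_smul, sub_neg_eq_add] at h0
  rw [norm_sq_comparison (logm C') (logm Z) t, sub_zero, abs_one, one_mul, zero_sub]
  have h2 := mul_le_mul_of_nonneg_left (pow_le_pow_left₀ (norm_nonneg _) h0 2) (sub_nonneg.2 ht.2)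
  have h3 := mul_le_mul_of_nonneg_left (pow_le_pow_left₀ (norm_nonneg _) h1 2) ht.1
  linarith

/-- The triangle inequality follows from the comparison inequality at the point dividing the
geodesic in the ratio of the two distances. -/
theorem dist_triangle' {A B C : Matrix ι ι 𝕜} (hA : A.PosDef) (hB : B.PosDef) (hC : C.PosDef) :
    dist A B ≤ dist A C + dist C B := by
  have hp := dist_nonneg' C A
  have hq := dist_nonneg' C B
  rw [dist_comm' hA hC]
  -- If one of the distances is 0, the factor `p * q` below vanishes and the comparison inequality
  -- says nothing.
  rcases hp.eq_or_lt with hp | hp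
  · rw [eq_of_dist_eq_zero' hC hA hp.symm, dist_self' hA, zero_add]
  rcases hq.eq_or_lt with hq | hq
  · rw [eq_of_dist_eq_zero' hC hB hq.symm, dist_self' hB, add_zero, dist_comm' hB hA]
  have h := dist_geodesic_sq_le hA hB hC (t := dist C A / (dist C A + dist C B))
    ⟨by positivity, by rw [div_le_one (by positivity)]; linarith⟩
  set p := dist C A
  set q := dist C B
  have hpq : 0 < p + q := by positivity
  have e : (1 - p / (p + q)) * p ^ 2 + p / (p + q) * q ^ 2 -
      p / (p + q) * (1 - p / (p + q)) * dist A B ^ 2 =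
        p * q / (p + q) ^ 2 * ((p + q) ^ 2 - dist A B ^ 2) := by
    field_simp
    ring
  rw [e] at h
  have h1 := nonneg_of_mul_nonneg_right ((sq_nonneg _).trans h) (by positivity)
  exact (sq_le_sq₀ (dist_nonneg' A B) hpq.le).1 (by linarith)

/-- After congruence to powers of one matrix the distance equals the norm of the difference of
logarithms, so the discrete inequality becomes an upper bound. It makes the distance continuous in
the matrix topology. -/
theorem dist_sq_le_traceForm {A B : Matrix ι ι 𝕜} (hA : A.PosDef) (hB : B.PosDef) :
    dist A B ^ 2 ≤ traceForm A B (B - A) := by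
  obtain ⟨S, Z, hS, hZ, rfl, rfl, -⟩ := exists_conj hA hB
  have h := norm_logm_sub_sq_le (PosDef.rpow hZ 0) (PosDef.rpow hZ 1)
  rw [← sub_mul, ← mul_sub, traceForm_conj hS.isUnit, dist_conj hS.isUnit, dist_rpow hZ]
  rwa [logm_rpow hZ, logm_rpow hZ, ← sub_smul, norm_smul, Real.norm_eq_abs] at h

variable (𝕜 ι) in
/-- The positive matrices. -/
abbrev Pos := {A : Matrix ι ι 𝕜 // A.PosDef}

/-- The Riemannian distance makes the positive matrices a metric space. -/
@[reducible] def posMetricSpace : MetricSpace (Pos 𝕜 ι) where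
  dist A B := dist A.1 B.1
  dist_self A := dist_self' A.2
  dist_comm A B := dist_comm' A.2 B.2
  dist_triangle A B C := dist_triangle' A.2 C.2 B.2
  eq_of_dist_eq_zero h := Subtype.ext (eq_of_dist_eq_zero' (Subtype.property _)
    (Subtype.property _) h)

theorem isCAT0_geodesic :
    @IsCAT0 (Pos 𝕜 ι) posMetricSpace fun A B t => ⟨geodesic A.1 B.1 t, geodesic_posDef A.2 B.2 t⟩ :=
  fun A B C _ ht => dist_geodesic_sq_le A.2 B.2 C.2 ht

/-! ### Existence of the mean and convergence of matrices -/

theorem continuousOn_dist {A : Matrix ι ι 𝕜} (hA : A.PosDef) :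
    ContinuousOn (fun C => dist A C) {C | C.PosDef} := by
  intro C hC
  have h0 := tendsto_sqrt_traceForm_sub (l := 𝓝[{C : Matrix ι ι 𝕜 | C.PosDef}] C)
    (B := fun B => B) hC (tendsto_id.mono_left nhdsWithin_le_nhds)
  refine tendsto_iff_norm_sub_tendsto_zero.2 ?_
  refine squeeze_zero' (Eventually.of_forall fun _ => norm_nonneg _) ?_ h0
  filter_upwards [self_mem_nhdsWithin] with B hB
  have h1 := dist_triangle' hA hB hC
  have h2 := dist_triangle' hA hC hB
  rw [dist_comm' hB hC] at h2
  refine le_trans (abs_le.2 ⟨by linarith, by linarith⟩) (Real.le_sqrt_of_sq_le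
    (dist_sq_le_traceForm hC hB))

theorem continuousOn_expm (R : ℝ) :
    ContinuousOn (expm (𝕜 := 𝕜) (ι := ι)) ({H | H.IsHermitian} ∩ Metric.closedBall 0 R) := by
  refine (LipschitzOnWith.of_dist_le_mul (K := (Real.exp R).toNNReal) ?_).continuousOn
  rintro H ⟨hH, hHR⟩ K ⟨hK, hKR⟩
  rw [dist_eq_norm, dist_eq_norm, Real.coe_toNNReal _ (Real.exp_pos R).le]
  exact norm_expm_sub_le hH hK (mem_closedBall_zero_iff.1 hHR) (mem_closedBall_zero_iff.1 hKR)

theorem isCompact_image_expm (R : ℝ) :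
    IsCompact (expm '' ({H : Matrix ι ι 𝕜 | H.IsHermitian} ∩ Metric.closedBall 0 R)) := by
  have : ProperSpace (Matrix ι ι 𝕜) := FiniteDimensional.proper ℝ _
  have hcl : IsClosed {H : Matrix ι ι 𝕜 | H.IsHermitian} :=
    isClosed_eq continuous_id.matrix_conjTranspose continuous_id
  exact ((isCompact_closedBall (0 : Matrix ι ι 𝕜) R).inter_left hcl).image_of_continuousOn
    (continuousOn_expm R)

theorem exists_isLeastSquaresMean {m : ℕ} [NeZero m] {A : Fin m → Matrix ι ι 𝕜}
    (hA : ∀ j, (A j).PosDef) : ∃ G, IsLeastSquaresMean A G := by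
  set f : Matrix ι ι 𝕜 → ℝ := fun C => ∑ j, dist (A j) C ^ 2 with hf
  have hf0 (C) : 0 ≤ f C := Finset.sum_nonneg fun j _ => sq_nonneg _
  -- Beyond this radius the single term `dist (A 0) C ^ 2` is already at least `f (A 0)`, so the
  -- minimum over the compact set `K`, which contains `A 0`, is global.
  set R := ‖logm (A 0)‖ + √(f (A 0)) with hR
  set K := expm '' ({H : Matrix ι ι 𝕜 | H.IsHermitian} ∩ Metric.closedBall 0 R) with hK
  have hmem {C : Matrix ι ι 𝕜} (hC : C.PosDef) (h : ‖logm C‖ ≤ R) : C ∈ K :=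
    ⟨logm C, ⟨isHermitian_logm C, mem_closedBall_zero_iff.2 h⟩, expm_logm hC⟩
  have hKpos : ∀ C ∈ K, C.PosDef := by
    rintro _ ⟨H, ⟨hH, -⟩, rfl⟩
    exact posDef_expm hH
  have hA0 : A 0 ∈ K := hmem (hA 0) (le_add_of_nonneg_right (Real.sqrt_nonneg _))
  have hfc : ContinuousOn f K := continuousOn_finsetSum _ fun j _ =>
    ((continuousOn_dist (hA j)).mono hKpos).pow 2
  obtain ⟨G, hG, hmin⟩ := (isCompact_image_expm R).exists_isMinOn ⟨_, hA0⟩ hfc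
  refine ⟨G, hKpos G hG, fun C hC => ?_⟩
  by_cases h : ‖logm C‖ ≤ R
  · exact hmin (hmem hC h)
  · refine (hmin hA0).trans ?_
    have h1 := norm_logm_sub_le_dist (hA 0) hC
    have h2 := norm_sub_norm_le (logm C) (logm (A 0))
    have h3 : √(f (A 0)) ≤ dist (A 0) C := by linarith
    have h4 := Finset.single_le_sum (f := fun j => dist (A j) C ^ 2) (fun j _ => sq_nonneg _)
      (Finset.mem_univ 0)
    exact ((Real.sqrt_le_left (dist_nonneg' _ _)).1 h3).trans h4

theorem tendsto_of_tendsto_dist {S : ℕ → Matrix ι ι 𝕜} {G : Matrix ι ι 𝕜} (hG : G.PosDef)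
    (hS : ∀ n, (S n).PosDef) (h : Tendsto (fun n => dist (S n) G) atTop (𝓝 0)) :
    Tendsto S atTop (𝓝 G) := by
  have h1 (n : ℕ) := norm_logm_sub_le_dist (hS n) hG
  have h2 : Tendsto (fun n => Real.exp (‖logm G‖ + 1) * dist (S n) G) atTop (𝓝 0) := by
    simpa using h.const_mul (Real.exp (‖logm G‖ + 1))
  have h3 : Tendsto (fun n => ‖S n - G‖) atTop (𝓝 0) := by
    refine squeeze_zero' (Eventually.of_forall fun _ => norm_nonneg _) ?_ h2
    filter_upwards [h.eventually_lt_const one_pos] with n hn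
    have h4 := norm_sub_norm_le (logm (S n)) (logm G)
    rw [norm_sub_rev] at h4
    have h5 := norm_expm_sub_le (isHermitian_logm (S n)) (isHermitian_logm G)
      (R := ‖logm G‖ + 1) (by linarith [h1 n]) (by linarith)
    rw [expm_logm (hS n), expm_logm hG, norm_sub_rev (logm (S n))] at h5
    exact h5.trans (mul_le_mul_of_nonneg_left (h1 n) (Real.exp_pos _).le)
  exact tendsto_iff_norm_sub_tendsto_zero.2 h3

/-! ### Inductive means of block sequences -/

theorem inductiveMean_posDef {X : ℕ → Matrix ι ι 𝕜} (hX : ∀ n, (X n).PosDef) :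
    ∀ n, (inductiveMean X n).PosDef
  | 0 => hX 0
  | 1 => hX 0
  | n + 2 => geodesic_posDef (inductiveMean_posDef hX (n + 1)) (hX (n + 1)) _

/-- Every block of `blockSeq` runs `k` times through the family `A`. -/
theorem sum_blockSeq {k m : ℕ} [NeZero k] [NeZero m] (A : Fin m → Matrix ι ι 𝕜)
    (σ : ℕ → Equiv.Perm (Fin (k * m))) (φ : Matrix ι ι 𝕜 → ℝ) (q : ℕ) :
    ∑ i ∈ Finset.range (k * m), φ (blockSeq A σ (q * (k * m) + i)) = k * ∑ j, φ (A j) := by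
  have hpos : 0 < k * m := Nat.pos_of_neZero _
  rw [Finset.sum_range]
  have h (i : Fin (k * m)) : blockSeq A σ (q * (k * m) + i) = A (σ q i).modNat := by
    have h1 : (q * (k * m) + i) / (k * m) = q := by
      rw [mul_comm, Nat.mul_add_div hpos, Nat.div_eq_of_lt i.2, add_zero]
    have h2 : Fin.ofNat (k * m) (q * (k * m) + i) = i := by
      ext
      rw [Fin.val_ofNat, Nat.mul_add_mod', Nat.mod_eq_of_lt i.2]
    rw [blockSeq, h1, h2]
  simp only [h]
  rw [Equiv.sum_comp (σ q) fun i => φ (A i.modNat),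
    ← Equiv.sum_comp finProdFinEquiv fun i : Fin (k * m) => φ (A i.modNat), Fintype.sum_prod_type]
  have h3 (a : Fin k) (b : Fin m) : (finProdFinEquiv (a, b)).modNat = b :=
    congrArg Prod.snd (finProdFinEquiv.symm_apply_apply (a, b))
  simp only [h3, Finset.sum_const, Finset.card_univ, Fintype.card_fin, nsmul_eq_mul]

theorem dist_inductiveMean_rate {m : ℕ} [NeZero m] {A : Fin m → Matrix ι ι 𝕜}
    (hA : ∀ j, (A j).PosDef) (k : ℕ) [NeZero k] {G : Matrix ι ι 𝕜} (hG : IsLeastSquaresMean A G) :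
    ∃ L : ℝ, 0 < L ∧ ∀ (σ : ℕ → Equiv.Perm (Fin (k * m))) (n : ℕ), 1 ≤ n →
      dist (inductiveMean (blockSeq A σ) n) G ^ 2 ≤ L / n := by
  set R := ∑ j, dist G (A j) with hR
  have hRj (j) : dist G (A j) ≤ R :=
    Finset.single_le_sum (f := fun j => dist G (A j)) (fun j _ => dist_nonneg' _ _)
      (Finset.mem_univ j)
  -- The summand 1 keeps the constant positive when `R = 0`, that is, when every `A j` equals `G`.
  refine ⟨(k * m : ℕ) * (12 * R ^ 2 * (k * m : ℕ) + 2 * R ^ 2) + 1, by positivity,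
    fun σ n hn => ?_⟩
  have hX (n) : (blockSeq A σ n).PosDef := hA _
  have h := @IsCAT0.inductiveMean_rate (Pos 𝕜 ι) posMetricSpace _ isCAT0_geodesic m
    (fun j => ⟨A j, hA j⟩) ⟨G, hG.1⟩ (fun C => hG.2 C.1 C.2) k (Nat.pos_of_neZero _) R hRj
    (fun n => ⟨blockSeq A σ n, hX n⟩)
    (fun n => ⟨inductiveMean (blockSeq A σ) n, inductiveMean_posDef hX n⟩)
    (fun n => ⟨_, rfl⟩) (fun q z => sum_blockSeq A σ (fun C => dist C z.1 ^ 2) q) rfl rfl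
    (fun n => rfl) n
  have hn' : (0 : ℝ) < n := by exact_mod_cast hn
  rw [le_div_iff₀ hn', mul_comm]
  exact h.trans (lt_add_one _).le

end PosMat

end

theorem mainTheorem2 {𝕜 : Type*} [RCLike 𝕜] {ι : Type*} [Fintype ι] [DecidableEq ι]
    {m : ℕ} [NeZero m] (A : Fin m → Matrix ι ι 𝕜) (hA : ∀ j, (A j).PosDef)
    (k : ℕ) [NeZero k] :
    ∃ G : Matrix ι ι 𝕜,
      (PosMat.IsLeastSquaresMean A G ∧ ∀ G', PosMat.IsLeastSquaresMean A G' → G' = G) ∧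
      (∃ L : ℝ, 0 < L ∧ ∀ (σ : ℕ → Equiv.Perm (Fin (k * m))) (n : ℕ), 1 ≤ n →
        PosMat.dist (PosMat.inductiveMean (PosMat.blockSeq A σ) n) G ^ 2 ≤ L / n) ∧
      ∀ σ : ℕ → Equiv.Perm (Fin (k * m)),
        Filter.Tendsto (PosMat.inductiveMean (PosMat.blockSeq A σ)) Filter.atTop (nhds G) := by
  obtain ⟨G, hG⟩ := PosMat.exists_isLeastSquaresMean hA
  obtain ⟨L, hL, hrate⟩ := PosMat.dist_inductiveMean_rate hA k hG
  refine ⟨G, ⟨hG, fun G' hG' => ?_⟩, ⟨L, hL, hrate⟩, fun σ => ?_⟩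
  · exact congrArg Subtype.val (@PosMat.IsCAT0.unique (PosMat.Pos 𝕜 ι) PosMat.posMetricSpace _
      PosMat.isCAT0_geodesic m _ (fun j => ⟨A j, hA j⟩) ⟨G, hG.1⟩ ⟨G', hG'.1⟩
      (fun C => hG.2 C.1 C.2) (fun C => hG'.2 C.1 C.2))
  · refine PosMat.tendsto_of_tendsto_dist hG.1 (PosMat.inductiveMean_posDef fun n => hA _) ?_
    have h0 : Filter.Tendsto (fun n : ℕ => √(L / n)) Filter.atTop (nhds 0) := by
      simpa using (tendsto_const_div_atTop_nhds_zero_nat L).sqrt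
    refine squeeze_zero' (Filter.Eventually.of_forall fun n => PosMat.dist_nonneg' _ _) ?_ h0
    filter_upwards [Filter.eventually_ge_atTop 1] with n hn
    exact Real.le_sqrt_of_sq_le (hrate σ n hn)
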